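/- Let $H$ be a Hopf algebra over a field $k$, with comultiplication $\Delta$ and antipode $S$ (not assumed bijective). A right (left) integral on $H$ is a linear functional $\chi:H\to k$ with $\sum\chi(a_{(1)})a_{(2)}=\chi(a)1$ (respectively $\sum a_{(1)}\chi(a_{(2)})=\chi(a)1$) for all $a\in H$. Regard $H$ as a right $H$-comodule via $\Delta$, and $k$ as the trivial right $H$-comodule via $1\mapsto 1\otimes 1$. For a finite-dimensional right $H$-comodule $M$, the dual $M^*$ is a right $H$-comodule by $\sum\varphi_{(0)}(x)\varphi_{(1)}=\sum\varphi(x_{(0)})S(x_{(1)})$. An injective envelope of a comodule $M$ is an injective morphism $i:M\to E$ of right $H$-comodules such that $E$ is injective in the category $\mathrm{Comod}\text{-}H$ of right $H$-comodules and every non-zero subcomodule of $E$ meets $i(M)$ non-trivially. Suppose that $H$ possesses a non-zero (left or right) integral. Then every injective envelope of the trivial comodule $k$ in $\mathrm{Comod}\text{-}H$ is finite-dimensional. More precisely, $H$ has a non-zero right integral, and for every non-zero right integral $\chi$ on $H$ the following hold. There are finite-dimensional right coideals $J$ of $H$ (that is, subspaces with $\Delta(J)\subseteq J\otimes H$) on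 which $\chi$ does not vanish identically; there is one of least dimension, and it is also minimal under inclusion among them. If $J$ is any finite-dimensional right coideal which is minimal under inclusion among those on which $\chi$ does not vanish, then the map $k\to J^*$, $1\mapsto\chi|_J$, is an injective envelope of $k$ in $\mathrm{Comod}\text{-}H$. -/

import Mathlib

open TensorProduct

universe u v w w' w''

namespace HopfComodule

section Antipode

variable {k : Type u} [Field k] {H : Type v} [Ring H] [HopfAlgebra k H]

open Coalgebra HopfAlgebra

/-- Helper: `∑ (S(r₁) ⊗ 1) Δ(r₂) = 1 ⊗ r`. -/
theorem antipode_mul_comul_aux (r : H) :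
    LinearMap.mul' k (H ⊗[k] H)
      (TensorProduct.map ((TensorProduct.mk k H H).flip 1 ∘ₗ antipode k) comul
        (comul (R := k) r)) = (1 : H) ⊗ₜ[k] r := by
  let Ψ : H ⊗[k] (H ⊗[k] H) →ₗ[k] H ⊗[k] H :=
    (LinearMap.mul' k H ∘ₗ (antipode k).rTensor H).rTensor H ∘ₗ
      (TensorProduct.assoc k H H H).symm.toLinearMap
  have h1 : LinearMap.mul' k (H ⊗[k] H) ∘ₗ
      TensorProduct.map ((TensorProduct.mk k H H).flip 1 ∘ₗ antipode k) comul
      = Ψ ∘ₗ (comul (R := k) (A := H)).lTensor H := by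
    have h2 : LinearMap.mul' k (H ⊗[k] H) ∘ₗ
        TensorProduct.map ((TensorProduct.mk k H H).flip 1 ∘ₗ antipode k) LinearMap.id = Ψ := by
      ext x y z
      simp [Ψ]
    rw [← h2, LinearMap.comp_assoc]
    congr 1
    ext x y
    simp
  have h3 := LinearMap.congr_fun h1 (comul (R := k) r)
  simp only [LinearMap.comp_apply] at h3
  rw [h3, ← coassoc_apply]
  simp only [Ψ, LinearMap.comp_apply, LinearEquiv.coe_coe, LinearEquiv.symm_apply_apply]
  rw [← LinearMap.comp_apply, ← LinearMap.rTensor_comp, LinearMap.comp_assoc,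
    mul_antipode_rTensor_comul, LinearMap.rTensor_comp, LinearMap.comp_apply,
    rTensor_counit_comul]
  simp

/-- Helper: the map `x ⊗ (y ⊗ z) ↦ (S(y) ⊗ S(x)) Δ(z)`. -/
noncomputable def antipodeComulAux (k : Type u) [Field k] (H : Type v) [Ring H] [HopfAlgebra k H] :
    H ⊗[k] (H ⊗[k] H) →ₗ[k] H ⊗[k] H :=
  LinearMap.mul' k (H ⊗[k] H) ∘ₗ
    TensorProduct.map (TensorProduct.map (antipode k) (antipode k) ∘ₗ
      (TensorProduct.comm k H H).toLinearMap) comul ∘ₗ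
    (TensorProduct.assoc k H H H).symm.toLinearMap

/-- Helper: `∑ (S(a₂) ⊗ S(a₁)) Δ(a₃) = ε(a) 1`. -/
theorem antipodeComulAux_apply (a : H) :
    antipodeComulAux k H (comul.lTensor H (comul (R := k) a)) =
      counit (R := k) a • ((1 : H) ⊗ₜ[k] (1 : H)) := by
  let K : H →ₗ[k] H ⊗[k] H := LinearMap.mul' k (H ⊗[k] H) ∘ₗ
      TensorProduct.map ((TensorProduct.mk k H H).flip 1 ∘ₗ antipode k) comul ∘ₗ comul
  have hK : K = TensorProduct.mk k H H 1 := by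
    ext r
    exact antipode_mul_comul_aux r
  have hΦ : antipodeComulAux k H ∘ₗ (comul (R := k) (A := H)).lTensor H =
      LinearMap.mul' k (H ⊗[k] H) ∘ₗ
        TensorProduct.map (TensorProduct.mk k H H 1 ∘ₗ antipode k) K := by
    have h2 : antipodeComulAux k H = LinearMap.mul' k (H ⊗[k] H) ∘ₗ
        TensorProduct.map (TensorProduct.mk k H H 1 ∘ₗ antipode k)
          (LinearMap.mul' k (H ⊗[k] H) ∘ₗ
            TensorProduct.map ((TensorProduct.mk k H H).flip 1 ∘ₗ antipode k) comul) := by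
      ext x y z
      simp [antipodeComulAux, ← mul_assoc]
    rw [h2, LinearMap.comp_assoc]
    congr 1
    ext x y
    simp [K]
  have h5 := LinearMap.congr_fun hΦ (comul (R := k) a)
  simp only [LinearMap.comp_apply] at h5
  rw [h5, hK]
  have h6 : LinearMap.mul' k (H ⊗[k] H) ∘ₗ
      TensorProduct.map (TensorProduct.mk k H H 1 ∘ₗ antipode k) (TensorProduct.mk k H H 1) =
      TensorProduct.mk k H H 1 ∘ₗ LinearMap.mul' k H ∘ₗ (antipode k).rTensor H := by
    ext x y
    simp
  have h7 := LinearMap.congr_fun h6 (comul (R := k) a)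
  simp only [LinearMap.comp_apply] at h7
  rw [h7, mul_antipode_rTensor_comul_apply]
  simp [Algebra.algebraMap_eq_smul_one]

/-- Helper: the two ways of writing the convolution product of `a ↦ ∑ S(a₂) ⊗ S(a₁)` and `Δ`. -/
theorem antipodeComulAux_assoc (t : H ⊗[k] H) :
    LinearMap.mul' k (H ⊗[k] H) (TensorProduct.map
      (TensorProduct.map (antipode k) (antipode k) ∘ₗ
        (TensorProduct.comm k H H).toLinearMap ∘ₗ comul) comul t) =
    antipodeComulAux k H (TensorProduct.assoc k H H H (comul.rTensor H t)) := by
  induction t using TensorProduct.induction_on with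
  | zero => simp only [map_zero]
  | tmul x y =>
    simp only [antipodeComulAux, LinearMap.comp_apply, LinearEquiv.coe_coe,
      LinearEquiv.symm_apply_apply, TensorProduct.map_tmul, LinearMap.rTensor_tmul]
  | add x y hx hy => simp only [map_add, hx, hy]

/-- The antipode is an anti-homomorphism of coalgebras: `Δ(S(a)) = ∑ S(a₂) ⊗ S(a₁)`. -/
theorem comul_comp_antipode :
    comul ∘ₗ antipode k (A := H) =
      TensorProduct.map (antipode k) (antipode k) ∘ₗ
        (TensorProduct.comm k H H).toLinearMap ∘ₗ comul := by
  symm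
  apply WithConv.toConv_injective
  refine left_inv_eq_right_inv (a := WithConv.toConv (comul (R := k) (A := H))) ?_
    LinearMap.comul_right_inv
  apply WithConv.ext
  rw [LinearMap.convMul_def, LinearMap.convOne_def]
  ext a
  simp only [LinearMap.comp_apply]
  refine (antipodeComulAux_assoc (comul (R := k) a)).trans ?_
  rw [coassoc_apply, antipodeComulAux_apply]
  simp [Algebra.algebraMap_eq_smul_one, Algebra.TensorProduct.one_def]

end Antipode

/-- A structure of right `H`-comodule on the `k`-space `M`: a linear map `ρ : M → M ⊗ H` that is
coassociative and counital. -/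
@[ext]
structure RightComodule (k : Type u) [Field k] (H : Type v) [Ring H] [HopfAlgebra k H]
    (M : Type w) [AddCommGroup M] [Module k M] where
  /-- the coaction `ρ` -/
  coact : M →ₗ[k] M ⊗[k] H
  /-- `(ρ ⊗ id) ρ = (id ⊗ Δ) ρ` -/
  coassoc : (TensorProduct.assoc k M H H).toLinearMap ∘ₗ coact.rTensor H ∘ₗ coact =
    (Coalgebra.comul (R := k) (A := H)).lTensor M ∘ₗ coact
  /-- `(id ⊗ ε) ρ = id` -/
  counit_coact : (TensorProduct.rid k M).toLinearMap ∘ₗ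
    (Coalgebra.counit (R := k) (A := H)).lTensor M ∘ₗ coact = LinearMap.id

namespace RightComodule

variable {k : Type u} [Field k] {H : Type v} [Ring H] [HopfAlgebra k H]
variable {M : Type w} [AddCommGroup M] [Module k M]
variable {N : Type w'} [AddCommGroup N] [Module k N]

/-- `f : M → N` is a morphism of right `H`-comodules: `ρ_N f = (f ⊗ id) ρ_M`. -/
def IsHom (ρ : RightComodule k H M) (σ : RightComodule k H N) (f : M →ₗ[k] N) : Prop :=
  σ.coact ∘ₗ f = f.rTensor H ∘ₗ ρ.coact

/-- The subspace `L` of `M` is a subcomodule: `ρ(L) ⊆ L ⊗ H` (the latter viewed inside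
`M ⊗ H`). -/
def IsSubcomodule (ρ : RightComodule k H M) (L : Submodule k M) : Prop :=
  ∀ x ∈ L, ρ.coact x ∈ LinearMap.range (L.subtype.rTensor H)

theorem rTensor_subtype_injective (L : Submodule k M) (P : Type w') [AddCommGroup P]
    [Module k P] : Function.Injective (L.subtype.rTensor P) :=
  Module.Flat.rTensor_preserves_injective_linearMap _ L.injective_subtype

/-- The restriction `L → L ⊗ H` of the coaction to a subcomodule `L`. -/
noncomputable def restrictCoact (ρ : RightComodule k H M) (L : Submodule k M)
    (hL : ρ.IsSubcomodule L) : L →ₗ[k] L ⊗[k] H :=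
  (LinearEquiv.ofInjective (L.subtype.rTensor H) (rTensor_subtype_injective L H)).symm.toLinearMap
    ∘ₗ (ρ.coact ∘ₗ L.subtype).codRestrict _ (fun x => hL x x.2)

theorem subtype_rTensor_comp_restrictCoact (ρ : RightComodule k H M) (L : Submodule k M)
    (hL : ρ.IsSubcomodule L) :
    L.subtype.rTensor H ∘ₗ ρ.restrictCoact L hL = ρ.coact ∘ₗ L.subtype := by
  ext x
  exact congrArg Subtype.val (LinearEquiv.apply_symm_apply
    (LinearEquiv.ofInjective (L.subtype.rTensor H) (rTensor_subtype_injective L H)) _)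

/-- A subcomodule as a right comodule. -/
noncomputable def restrict (ρ : RightComodule k H M) (L : Submodule k M)
    (hL : ρ.IsSubcomodule L) : RightComodule k H L where
  coact := ρ.restrictCoact L hL
  coassoc := by
    have hc := ρ.subtype_rTensor_comp_restrictCoact L hL
    set c := ρ.restrictCoact L hL
    have hnat : L.subtype.rTensor (H ⊗[k] H) ∘ₗ (TensorProduct.assoc k L H H).toLinearMap =
        (TensorProduct.assoc k M H H).toLinearMap ∘ₗ (L.subtype.rTensor H).rTensor H := by
      ext x y z
      simp
    have hnat' : L.subtype.rTensor (H ⊗[k] H) ∘ₗ (Coalgebra.comul (R := k) (A := H)).lTensor L =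
        (Coalgebra.comul (R := k) (A := H)).lTensor M ∘ₗ L.subtype.rTensor H := by
      ext x y
      simp
    have hrT : (L.subtype.rTensor H).rTensor H ∘ₗ c.rTensor H =
        ρ.coact.rTensor H ∘ₗ L.subtype.rTensor H := by
      rw [← LinearMap.rTensor_comp, hc, LinearMap.rTensor_comp]
    ext x
    apply rTensor_subtype_injective L (H ⊗[k] H)
    calc L.subtype.rTensor (H ⊗[k] H) (TensorProduct.assoc k L H H (c.rTensor H (c x)))
        = TensorProduct.assoc k M H H ((L.subtype.rTensor H).rTensor H (c.rTensor H (c x))) :=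
          LinearMap.congr_fun hnat _
      _ = TensorProduct.assoc k M H H (ρ.coact.rTensor H (L.subtype.rTensor H (c x))) :=
          congrArg _ (LinearMap.congr_fun hrT _)
      _ = TensorProduct.assoc k M H H (ρ.coact.rTensor H (ρ.coact x)) :=
          congrArg _ (congrArg _ (LinearMap.congr_fun hc x))
      _ = (Coalgebra.comul (R := k) (A := H)).lTensor M (ρ.coact x) :=
          LinearMap.congr_fun ρ.coassoc x
      _ = (Coalgebra.comul (R := k) (A := H)).lTensor M (L.subtype.rTensor H (c x)) :=
          congrArg _ (LinearMap.congr_fun hc x).symm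
      _ = _ := (LinearMap.congr_fun hnat' (c x)).symm
  counit_coact := by
    have hc := ρ.subtype_rTensor_comp_restrictCoact L hL
    set c := ρ.restrictCoact L hL
    have hnat : L.subtype ∘ₗ (TensorProduct.rid k L).toLinearMap ∘ₗ
        (Coalgebra.counit (R := k) (A := H)).lTensor L =
        (TensorProduct.rid k M).toLinearMap ∘ₗ
        (Coalgebra.counit (R := k) (A := H)).lTensor M ∘ₗ L.subtype.rTensor H := by
      ext x y
      simp
    have key : L.subtype ∘ₗ ((TensorProduct.rid k L).toLinearMap ∘ₗ
        (Coalgebra.counit (R := k) (A := H)).lTensor L ∘ₗ c) = L.subtype ∘ₗ LinearMap.id := by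
      have h1 : L.subtype ∘ₗ ((TensorProduct.rid k L).toLinearMap ∘ₗ
          (Coalgebra.counit (R := k) (A := H)).lTensor L ∘ₗ c) =
          (TensorProduct.rid k M).toLinearMap ∘ₗ
          (Coalgebra.counit (R := k) (A := H)).lTensor M ∘ₗ (L.subtype.rTensor H ∘ₗ c) :=
        congrArg (fun f => f ∘ₗ c) hnat
      rw [h1, hc]
      exact congrArg (fun f => f ∘ₗ L.subtype) ρ.counit_coact
    ext x
    exact LinearMap.congr_fun key x

/-- The right comodule `H`, with coaction `Δ`. -/
def regular (k : Type u) [Field k] (H : Type v) [Ring H] [HopfAlgebra k H] :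
    RightComodule k H H where
  coact := Coalgebra.comul
  coassoc := Coalgebra.coassoc
  counit_coact := by
    rw [Coalgebra.lTensor_counit_comp_comul]
    ext x
    simp

/-- The trivial right comodule `k`, with coaction `1 ↦ 1 ⊗ 1`. -/
def trivial (k : Type u) [Field k] (H : Type v) [Ring H] [HopfAlgebra k H] :
    RightComodule k H k where
  coact := (TensorProduct.mk k k H).flip 1
  coassoc := by
    ext
    simp [Algebra.TensorProduct.one_def]
  counit_coact := by
    ext
    simp

/-- The linear map `M → H`, `x ↦ ∑ φ(x₀) S(x₁)`, depending linearly on `φ ∈ M^*`. -/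
noncomputable def dualHom (ρ : RightComodule k H M) : Module.Dual k M →ₗ[k] (M →ₗ[k] H) where
  toFun φ := HopfAlgebra.antipode k ∘ₗ (TensorProduct.lid k H).toLinearMap ∘ₗ φ.rTensor H ∘ₗ ρ.coact
  map_add' φ ψ := by
    ext x
    simp [LinearMap.rTensor_add]
  map_smul' a φ := by
    ext x
    simp [LinearMap.rTensor_smul]

/-- The coaction `M^* → M^* ⊗ H` on the dual of a finite-dimensional comodule: `ρ(φ)` is the element
of `M^* ⊗ H` which corresponds to the map `x ↦ ∑ φ(x₀) S(x₁)` under `M^* ⊗ H ≅ Hom(M, H)`. -/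
noncomputable def dualCoact (ρ : RightComodule k H M) [FiniteDimensional k M] :
    Module.Dual k M →ₗ[k] Module.Dual k M ⊗[k] H :=
  (dualTensorHomEquiv k M H).symm.toLinearMap ∘ₗ ρ.dualHom

/-- `∑ φ₀(x) φ₁ = ∑ φ(x₀) S(x₁)`. -/
theorem dualTensorHom_dualCoact (ρ : RightComodule k H M) [FiniteDimensional k M]
    (φ : Module.Dual k M) (x : M) :
    dualTensorHom k M H (ρ.dualCoact φ) x =
      HopfAlgebra.antipode k (TensorProduct.lid k H (φ.rTensor H (ρ.coact x))) :=
  LinearMap.congr_fun ((dualTensorHomEquiv k M H).apply_symm_apply (ρ.dualHom φ)) x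

/-- The (left) dual `M^*` of a finite-dimensional right comodule `M`, again a right comodule. -/
noncomputable def dual (ρ : RightComodule k H M) [FiniteDimensional k M] :
    RightComodule k H (Module.Dual k M) where
  coact := ρ.dualCoact
  coassoc := by
    let S : H →ₗ[k] H := HopfAlgebra.antipode k
    ext1 φ
    apply (dualTensorHom_bijective (R := k) (M := M) (N := H ⊗[k] H)).1
    ext1 x
    have h0 : ∀ (s : Module.Dual k M ⊗[k] H) (h : H),
        dualTensorHom k M (H ⊗[k] H) (TensorProduct.assoc k _ H H (s ⊗ₜ h)) x =
          dualTensorHom k M H s x ⊗ₜ h := by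
      intro s h
      induction s using TensorProduct.induction_on with
      | zero => simp
      | tmul f g => simp [TensorProduct.smul_tmul']
      | add a b ha hb => simp only [TensorProduct.add_tmul, map_add, LinearMap.add_apply, ha, hb]
    have h1 : ∀ t : Module.Dual k M ⊗[k] H,
        dualTensorHom k M (H ⊗[k] H)
          (TensorProduct.assoc k _ H H (ρ.dualCoact.rTensor H t)) x =
        TensorProduct.map S (dualTensorHom k M H t)
          (TensorProduct.comm k M H (ρ.coact x)) := by
      intro t
      induction t using TensorProduct.induction_on with
      | zero => simp
      | tmul f h =>
        rw [LinearMap.rTensor_tmul, h0, dualTensorHom_dualCoact]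
        generalize ρ.coact x = y
        induction y using TensorProduct.induction_on with
        | zero => simp
        | tmul m g => simp [S, TensorProduct.smul_tmul]
        | add a b ha hb => simp only [map_add, TensorProduct.add_tmul, ha, hb]
      | add a b ha hb =>
        simp only [map_add, LinearMap.add_apply, ha, hb, TensorProduct.map_add_right]
    have h2 : ∀ t : Module.Dual k M ⊗[k] H,
        dualTensorHom k M (H ⊗[k] H)
          ((Coalgebra.comul (R := k) (A := H)).lTensor _ t) x =
        Coalgebra.comul (R := k) (dualTensorHom k M H t x) := by
      intro t
      exact LinearMap.congr_fun (LinearMap.congr_fun (dualTensorHom_comp_lTensor _) t) x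
    let Ψ : M ⊗[k] (H ⊗[k] H) →ₗ[k] H ⊗[k] H :=
      TensorProduct.map S S ∘ₗ (TensorProduct.comm k H H).toLinearMap ∘ₗ
        (TensorProduct.lid k (H ⊗[k] H)).toLinearMap ∘ₗ φ.rTensor (H ⊗[k] H)
    have h3 : ∀ y : M ⊗[k] H, TensorProduct.map S (dualTensorHom k M H (ρ.dualCoact φ))
        (TensorProduct.comm k M H y) =
        Ψ (TensorProduct.assoc k M H H (ρ.coact.rTensor H y)) := by
      intro y
      induction y using TensorProduct.induction_on with
      | zero => simp
      | tmul m h =>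
        simp only [TensorProduct.comm_tmul, TensorProduct.map_tmul, LinearMap.rTensor_tmul]
        rw [dualTensorHom_dualCoact]
        generalize ρ.coact m = z
        induction z using TensorProduct.induction_on with
        | zero => simp
        | tmul m g => simp [S, Ψ]
        | add a b ha hb => simp only [map_add, TensorProduct.add_tmul, TensorProduct.tmul_add, ha, hb]
      | add a b ha hb => simp only [map_add, ha, hb]
    have h4 : ∀ y : M ⊗[k] H, Coalgebra.comul (R := k)
        (S (TensorProduct.lid k H (φ.rTensor H y))) =
        Ψ ((Coalgebra.comul (R := k) (A := H)).lTensor M y) := by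
      intro y
      have h5 := LinearMap.congr_fun (comul_comp_antipode (k := k) (H := H))
        (TensorProduct.lid k H (φ.rTensor H y))
      refine h5.trans ?_
      clear h5
      induction y using TensorProduct.induction_on with
      | zero => simp
      | tmul m h => simp [S, Ψ]
      | add a b ha hb => simp only [map_add, LinearMap.comp_apply] at ha hb ⊢; rw [ha, hb]
    simp only [LinearMap.comp_apply, LinearEquiv.coe_coe]
    rw [h1, h2, dualTensorHom_dualCoact, h3, h4]
    exact congrArg Ψ (LinearMap.congr_fun ρ.coassoc x)
  counit_coact := by
    ext φ x
    have h1 : ∀ t : Module.Dual k M ⊗[k] H,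
        TensorProduct.rid k _ ((Coalgebra.counit (R := k) (A := H)).lTensor _ t) x =
        Coalgebra.counit (R := k) (dualTensorHom k M H t x) := by
      intro t
      induction t using TensorProduct.induction_on with
      | zero => simp
      | tmul f h => simp [mul_comm]
      | add a b ha hb => simp only [map_add, LinearMap.add_apply, ha, hb]
    have h2 : ∀ y : M ⊗[k] H, Coalgebra.counit (R := k) (TensorProduct.lid k H (φ.rTensor H y)) =
        φ (TensorProduct.rid k M ((Coalgebra.counit (R := k) (A := H)).lTensor M y)) := by
      intro y
      induction y using TensorProduct.induction_on with
      | zero => simp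
      | tmul m h => simp [mul_comm]
      | add a b ha hb => simp only [map_add, ha, hb]
    simp only [LinearMap.comp_apply, LinearEquiv.coe_coe, LinearMap.id_apply]
    rw [h1, dualTensorHom_dualCoact, HopfAlgebra.counit_antipode, h2]
    exact congrArg φ (LinearMap.congr_fun ρ.counit_coact x)

/-- `I` is an injective object of the category of right `H`-comodules: morphisms into `I` extend
along injective morphisms. -/
def IsInjective (σ : RightComodule k H N) : Prop :=
  ∀ (X Y : Type w'') [AddCommGroup X] [Module k X] [AddCommGroup Y] [Module k Y]
    (ρX : RightComodule k H X) (ρY : RightComodule k H Y) (f : X →ₗ[k] Y) (g : X →ₗ[k] N),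
    ρX.IsHom ρY f → Function.Injective f → ρX.IsHom σ g →
    ∃ h : Y →ₗ[k] N, ρY.IsHom σ h ∧ h ∘ₗ f = g

/-- `i : M → E` exhibits the comodule `E` as an injective envelope of `M`: `i` is an injective
morphism, `E` is injective, and `E` is an essential extension of `i(M)`, that is, every non-zero
subcomodule of `E` meets `i(M)` non-trivially. -/
structure IsInjectiveEnvelope (ρ : RightComodule k H M) (σ : RightComodule k H N)
    (i : M →ₗ[k] N) : Prop where
  isHom : ρ.IsHom σ i
  injective : Function.Injective i
  isInjective : IsInjective.{u, v, w', w''} σ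
  essential : ∀ L : Submodule k N, σ.IsSubcomodule L → L ≠ ⊥ → L ⊓ LinearMap.range i ≠ ⊥

end RightComodule
/-- A right integral on `H`: a linear functional `χ` with `∑ χ(a₁) a₂ = χ(a) 1` for all `a`. -/
def IsRightIntegral {k : Type u} [Field k] {H : Type v} [Ring H] [HopfAlgebra k H]
    (χ : H →ₗ[k] k) : Prop :=
  ∀ a : H, TensorProduct.lid k H (χ.rTensor H (Coalgebra.comul (R := k) a)) = χ a • (1 : H)

/-- A left integral on `H`: a linear functional `χ` with `∑ a₁ χ(a₂) = χ(a) 1` for all `a`. -/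
def IsLeftIntegral {k : Type u} [Field k] {H : Type v} [Ring H] [HopfAlgebra k H]
    (χ : H →ₗ[k] k) : Prop :=
  ∀ a : H, TensorProduct.rid k H (χ.lTensor H (Coalgebra.comul (R := k) a)) = χ a • (1 : H)

/-- `J` is a finite-dimensional right coideal (right subcomodule) of `H`, `Δ(J) ⊆ J ⊗ H`, on which
`χ` does not vanish. -/
structure IsNonvanishingCoideal {k : Type u} [Field k] {H : Type v} [Ring H] [HopfAlgebra k H]
    (χ : H →ₗ[k] k) (J : Submodule k H) : Prop where
  isSubcomodule : (RightComodule.regular k H).IsSubcomodule J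
  finiteDimensional : FiniteDimensional k J
  nonvanishing : ∃ x ∈ J, χ x ≠ 0

/-- The linear map `k → J^*` sending `1` to the restriction of `χ` to `J`. -/
noncomputable def restrictionMap {k : Type u} [Field k] {H : Type v} [Ring H] [HopfAlgebra k H]
    (χ : H →ₗ[k] k) (J : Submodule k H) : k →ₗ[k] Module.Dual k J :=
  LinearMap.toSpanSingleton k (Module.Dual k J) (χ.domRestrict J)

end HopfComodule

/-!
# Integrals and the injective envelope of the trivial comodule

Everything rests on three identities for integrals, in Sweedler notation, each obtained by solving
an equation in the convolution algebra `Hom(H, H)`, where the antipode `S` is inverse to `id`: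

* `∑ χ(h₁ x) h₂ = ∑ χ(h x₁) S(x₂)` for a right integral `χ` (`IsRightIntegral.sliceLeft_mulRight`),
* `∑ χ(S(h) x₁) x₂ = ∑ h₁ χ(S(h₂) x)` for a right integral `χ`
  (`IsRightIntegral.sliceLeft_antipode_mul`),
* `∑ h₁ χ(x h₂) = ∑ S(x₁) χ(x₂ h)` for a left integral `χ` (`IsLeftIntegral.sliceRight_mulLeft`).

The last two show that the left kernel of `χ(S(h) x)`, respectively the right kernel of `χ(x h)`, is
both a left ideal and a left coideal. Such a subspace is zero unless it contains `1`
(`eq_bot_of_isLeftIdeal_of_isLeftCoideal`). So `S` is injective when there is a non-zero right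
integral (`IsRightIntegral.antipode_injective`), and if `χ` is a non-zero left integral then
`χ ∘ S` is a non-zero right integral (`IsLeftIntegral.isRightIntegral_comp_antipode`,
`IsLeftIntegral.comp_antipode_ne_zero`).

Let `χ` be a right integral. The first identity says that `Θ : H → J^*`, `Θ(h)(x) = χ(h x)`, is a
morphism of comodules for every finite-dimensional right coideal `J`
(`isHom_translateRestrict`); it sends `1` to `χ|_J`. If `k → E` is an essential extension of the
trivial comodule, then a functional `g` on `E` which is `1` at the image of `1` gives a morphism
`E → H`, `x ↦ ∑ g(x₀) x₁`, and its composite with `Θ` does not kill the image of `1` when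
`χ|_J ≠ 0`. By essentiality it embeds `E` in `J^*`, so `E` is finite-dimensional.

If `J` is minimal among the coideals on which `χ` does not vanish, then `J^*` is an essential
extension of `k χ|_J`: annihilators of subcomodules of `J^*` are subcomodules of `J`, because `S`
is injective (`essential_restrictionMap`). The previous construction for `E = J^*` then gives an
injective, hence bijective, endomorphism of `J^*` which factors through `H`. Thus `J^*` is a
retract of the regular comodule `H`, which is injective (`isInjective_dual_restrict`).
-/

namespace HopfComodule

/-! ### Slices of tensors -/

section Slice

variable {k : Type u} [Field k] {M : Type w} [AddCommGroup M] [Module k M]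
variable {V : Type w'} [AddCommGroup V] [Module k V]
variable {N : Type w''} [AddCommGroup N] [Module k N]

/-- The slice map `f ⊗ id : V ⊗ M → k ⊗ M ≅ M`. -/
noncomputable def sliceLeft (f : V →ₗ[k] k) : V ⊗[k] M →ₗ[k] M :=
  (TensorProduct.lid k M).toLinearMap ∘ₗ f.rTensor M

/-- The slice map `id ⊗ f : M ⊗ V → M ⊗ k ≅ M`. -/
noncomputable def sliceRight (f : V →ₗ[k] k) : M ⊗[k] V →ₗ[k] M :=
  (TensorProduct.rid k M).toLinearMap ∘ₗ f.lTensor M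

@[simp]
theorem sliceLeft_tmul (f : V →ₗ[k] k) (x : V) (m : M) : sliceLeft f (x ⊗ₜ[k] m) = f x • m := by
  simp [sliceLeft]

@[simp]
theorem sliceRight_tmul (f : V →ₗ[k] k) (m : M) (x : V) :
    sliceRight f (m ⊗ₜ[k] x) = f x • m := by
  simp [sliceRight]

theorem map_sliceLeft (g : M →ₗ[k] N) (f : V →ₗ[k] k) (t : V ⊗[k] M) :
    g (sliceLeft f t) = sliceLeft f (g.lTensor V t) := by
  induction t with
  | zero => simp
  | tmul x y => simp
  | add a b ha hb => simp only [map_add, ha, hb]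

theorem map_sliceRight (g : M →ₗ[k] N) (f : V →ₗ[k] k) (t : M ⊗[k] V) :
    g (sliceRight f t) = sliceRight f (g.rTensor V t) := by
  induction t with
  | zero => simp
  | tmul x y => simp
  | add a b ha hb => simp only [map_add, ha, hb]

theorem apply_sliceLeft (g : M →ₗ[k] k) (f : V →ₗ[k] k) (t : V ⊗[k] M) :
    g (sliceLeft f t) = f (sliceRight g t) := by
  induction t with
  | zero => simp
  | tmul x y => simp [mul_comm]
  | add a b ha hb => simp only [map_add, ha, hb]

/-- A tensor all of whose slices lie in `L` lies in `L ⊗ V`. -/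
theorem mem_range_rTensor_subtype (L : Submodule k M) (t : M ⊗[k] V)
    (h : ∀ f : V →ₗ[k] k, sliceRight f t ∈ L) : t ∈ LinearMap.range (L.subtype.rTensor V) := by
  classical
  let b := Module.Basis.ofVectorSpace k V
  rw [← (TensorProduct.equivFinsuppOfBasisRight b).symm_apply_apply t,
    TensorProduct.equivFinsuppOfBasisRight_symm_apply]
  refine Submodule.sum_mem _ fun i _ => ?_
  rw [TensorProduct.equivFinsuppOfBasisRight_apply]
  exact ⟨(⟨_, h (b.coord i)⟩ : L) ⊗ₜ b i, rfl⟩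

theorem mem_range_lTensor_subtype (L : Submodule k M) (t : V ⊗[k] M)
    (h : ∀ f : V →ₗ[k] k, sliceLeft f t ∈ L) : t ∈ LinearMap.range (L.subtype.lTensor V) := by
  classical
  let b := Module.Basis.ofVectorSpace k V
  rw [← (TensorProduct.equivFinsuppOfBasisLeft b).symm_apply_apply t,
    TensorProduct.equivFinsuppOfBasisLeft_symm_apply]
  refine Submodule.sum_mem _ fun i _ => ?_
  rw [TensorProduct.equivFinsuppOfBasisLeft_apply]
  exact ⟨b i ⊗ₜ (⟨_, h (b.coord i)⟩ : L), rfl⟩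

theorem sliceRight_mem_of_mem_range (L : Submodule k M) {t : M ⊗[k] V}
    (h : t ∈ LinearMap.range (L.subtype.rTensor V)) (f : V →ₗ[k] k) : sliceRight f t ∈ L := by
  obtain ⟨s, rfl⟩ := h
  rw [← map_sliceRight]
  exact (sliceRight f s).2

end Slice

/-! ### Integrals and the antipode -/

section Integral

variable {k : Type u} [Field k] {H : Type v} [Ring H] [HopfAlgebra k H]

open Coalgebra HopfAlgebra WithConv LinearMap

/-- The left Hopf module argument: a left ideal `N` which is a left coideal contains
`∑ S(n₁) n₂ = ε(n) 1` for `n ∈ N`, hence it is zero unless it contains `1`. -/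
theorem eq_bot_of_isLeftIdeal_of_isLeftCoideal (N : Submodule k H)
    (hmul : ∀ g : H, ∀ n ∈ N, g * n ∈ N)
    (hcomul : ∀ n ∈ N, ∀ f : H →ₗ[k] k, sliceLeft f (comul (R := k) n) ∈ N)
    (hone : (1 : H) ∉ N) : N = ⊥ := by
  have hε : ∀ n ∈ N, counit (R := k) n = 0 := by
    intro n hn
    by_contra hc
    apply hone
    have h1 : mul' k H ((antipode k).rTensor H (comul (R := k) n)) ∈ N := by
      obtain ⟨s, hs⟩ := mem_range_lTensor_subtype N _ (hcomul n hn)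
      rw [← hs]
      clear hs
      induction s with
      | zero => simp
      | tmul x y => simpa using hmul _ _ y.2
      | add a b ha hb =>
        simp only [map_add]
        exact N.add_mem ha hb
    rw [mul_antipode_rTensor_comul_apply, Algebra.algebraMap_eq_smul_one] at h1
    exact (N.smul_mem_iff hc).1 h1
  rw [eq_bot_iff]
  intro n hn
  have h0 : ∀ f : H →ₗ[k] k, f n = 0 := by
    intro f
    have h1 := hε _ (hcomul n hn f)
    rw [apply_sliceLeft] at h1
    simpa [sliceRight] using h1
  simpa using (Module.forall_dual_apply_eq_zero_iff k n).1 h0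

/-- In the convolution algebra, `T * id = U` gives `T = U * S`. -/
theorem eq_conv_antipode {T U : H →ₗ[k] H}
    (h : ∀ x, mul' k H (map T LinearMap.id (comul (R := k) x)) = U x) (x : H) :
    T x = mul' k H (map U (antipode k) (comul (R := k) x)) := by
  have h1 : toConv T * toConv LinearMap.id = toConv U := by
    ext x; exact h x
  have h2 : toConv T = toConv U * toConv (antipode k) := by
    rw [← h1, mul_assoc, id_mul_antipode, mul_one]
  exact LinearMap.congr_fun (congrArg WithConv.ofConv h2) x

/-- In the convolution algebra, `id * T = U` gives `T = S * U`. -/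
theorem eq_antipode_conv {T U : H →ₗ[k] H}
    (h : ∀ x, mul' k H (map LinearMap.id T (comul (R := k) x)) = U x) (x : H) :
    T x = mul' k H (map (antipode k) U (comul (R := k) x)) := by
  have h1 : toConv LinearMap.id * toConv T = toConv U := by
    ext x; exact h x
  have h2 : toConv T = toConv (antipode k) * toConv U := by
    rw [← h1, ← mul_assoc, antipode_mul_id, one_mul]
  exact LinearMap.congr_fun (congrArg WithConv.ofConv h2) x

/-- In the convolution algebra, `S * T = U` gives `T = id * U`. -/
theorem eq_id_conv {T U : H →ₗ[k] H}
    (h : ∀ x, mul' k H (map (antipode k) T (comul (R := k) x)) = U x) (x : H) :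
    T x = mul' k H (map LinearMap.id U (comul (R := k) x)) := by
  have h1 : toConv (antipode k) * toConv T = toConv U := by
    ext x; exact h x
  have h2 : toConv T = toConv LinearMap.id * toConv U := by
    rw [← h1, ← mul_assoc, id_mul_antipode, one_mul]
  exact LinearMap.congr_fun (congrArg WithConv.ofConv h2) x

/-- `∑ χ(h₁ x) h₂ = ∑ χ(h x₁) S(x₂)` for a right integral `χ`. -/
theorem IsRightIntegral.sliceLeft_mulRight {χ : H →ₗ[k] k} (hχ : IsRightIntegral χ) (h x : H) :
    sliceLeft (χ ∘ₗ mulRight k x) (comul (R := k) h) =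
      antipode k (sliceLeft (χ ∘ₗ mulLeft k h) (comul (R := k) x)) := by
  -- For `t = Δ(h)`, `T t` is `x ↦ ∑ χ(h₁ x) h₂`, and `T t * id = χ(h ·) 1`.
  let T : H ⊗[k] H → H →ₗ[k] H := fun t =>
    sliceLeft χ ∘ₗ mulLeft k t ∘ₗ (TensorProduct.mk k H H).flip 1
  have hT : ∀ t s, mul' k H (map (T t) LinearMap.id s) = sliceLeft χ (t * s) := by
    intro t s
    induction s with
    | zero => simp
    | add a b ha hb => simp only [map_add, mul_add, ha, hb]
    | tmul a b =>
      simp only [T, map_tmul, mul'_apply, id_apply, LinearMap.comp_apply, flip_apply, mk_apply,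
        mulLeft_apply]
      induction t with
      | zero => simp
      | add c d hc hd => simp only [map_add, add_mul] at hc hd ⊢; rw [hc, hd]
      | tmul c d => simp
  have h1 := eq_conv_antipode (T := T (comul (R := k) h))
    (U := toSpanSingleton k H 1 ∘ₗ χ ∘ₗ mulLeft k h) (fun x => by
      rw [hT, ← Bialgebra.comul_mul]
      exact hχ _) x
  have h2 : ∀ t, T t x = sliceLeft (χ ∘ₗ mulRight k x) t := by
    intro t
    induction t with
    | zero => simp [T]
    | add c d hc hd => simpa [T, add_mul] using congrArg₂ (· + ·) hc hd
    | tmul c d => simp [T]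
  rw [← h2, h1, map_sliceLeft]
  generalize comul (R := k) x = s
  induction s with
  | zero => simp
  | add a b ha hb => simp only [map_add, ha, hb]
  | tmul a b => simp

/-- `∑ χ(S(h) x₁) x₂ = ∑ h₁ χ(S(h₂) x)` for a right integral `χ`. -/
theorem IsRightIntegral.sliceLeft_antipode_mul {χ : H →ₗ[k] k} (hχ : IsRightIntegral χ) (h x : H) :
    sliceLeft (χ ∘ₗ mulLeft k (antipode k h)) (comul (R := k) x) =
      sliceRight (χ ∘ₗ mulRight k x ∘ₗ antipode k) (comul (R := k) h) := by
  -- For `t = Δ(x)`, `T t` is `h ↦ ∑ χ(S(h) x₁) x₂`, and `S * T t = χ(S(·) x) 1`, by the integral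
  -- property of `χ` at `S(h) x` and `Δ(S(h)) = ∑ S(h₂) ⊗ S(h₁)`.
  let T : H ⊗[k] H → H →ₗ[k] H := fun t =>
    sliceLeft χ ∘ₗ mulRight k t ∘ₗ (TensorProduct.mk k H H).flip 1 ∘ₗ antipode k
  have hT : ∀ t s, mul' k H (map (antipode k) (T t) s) =
      sliceLeft χ (map (antipode k) (antipode k) (TensorProduct.comm k H H s) * t) := by
    intro t s
    induction s with
    | zero => simp
    | add a b ha hb => simp only [map_add, add_mul, ha, hb]
    | tmul a b =>
      simp only [T, map_tmul, mul'_apply, LinearMap.comp_apply, flip_apply, mk_apply,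
        mulRight_apply, comm_tmul]
      induction t with
      | zero => simp
      | add c d hc hd => simp only [map_add, mul_add] at hc hd ⊢; rw [hc, hd]
      | tmul c d => simp
  have h1 := eq_id_conv (T := T (comul (R := k) x))
    (U := toSpanSingleton k H 1 ∘ₗ χ ∘ₗ mulRight k x ∘ₗ antipode k) (fun h => by
      have h3 : map (antipode k) (antipode k) (TensorProduct.comm k H H (comul (R := k) h)) =
        comul (R := k) (antipode k h) :=
        (LinearMap.congr_fun (comul_comp_antipode (k := k) (H := H)) h).symm
      rw [hT, h3, ← Bialgebra.comul_mul]
      exact hχ _) h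
  have h2 : ∀ t, T t h = sliceLeft (χ ∘ₗ mulLeft k (antipode k h)) t := by
    intro t
    induction t with
    | zero => simp [T]
    | add c d hc hd => simpa [T, mul_add] using congrArg₂ (· + ·) hc hd
    | tmul c d => simp [T]
  rw [← h2, h1]
  generalize comul (R := k) h = s
  induction s with
  | zero => simp
  | add a b ha hb => simp only [map_add, ha, hb]
  | tmul a b => simp

/-- `∑ h₁ χ(x h₂) = ∑ S(x₁) χ(x₂ h)` for a left integral `χ`. -/
theorem IsLeftIntegral.sliceRight_mulLeft {χ : H →ₗ[k] k} (hχ : IsLeftIntegral χ) (h x : H) :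
    sliceRight (χ ∘ₗ mulLeft k x) (comul (R := k) h) =
      antipode k (sliceRight (χ ∘ₗ mulRight k h) (comul (R := k) x)) := by
  -- For `t = Δ(h)`, `T t` is `x ↦ ∑ h₁ χ(x h₂)`, and `id * T t = χ(· h) 1`.
  let T : H ⊗[k] H → H →ₗ[k] H := fun t =>
    sliceRight χ ∘ₗ mulRight k t ∘ₗ TensorProduct.mk k H H 1
  have hT : ∀ t s, mul' k H (map LinearMap.id (T t) s) = sliceRight χ (s * t) := by
    intro t s
    induction s with
    | zero => simp
    | add a b ha hb => simp only [map_add, add_mul, ha, hb]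
    | tmul a b =>
      simp only [T, map_tmul, mul'_apply, id_apply, LinearMap.comp_apply, mk_apply, mulRight_apply]
      induction t with
      | zero => simp
      | add c d hc hd => simp only [map_add, mul_add] at hc hd ⊢; rw [hc, hd]
      | tmul c d => simp
  have h1 := eq_antipode_conv (T := T (comul (R := k) h))
    (U := toSpanSingleton k H 1 ∘ₗ χ ∘ₗ mulRight k h) (fun x => by
      rw [hT, ← Bialgebra.comul_mul]
      exact hχ _) x
  have h2 : ∀ t, T t x = sliceRight (χ ∘ₗ mulLeft k x) t := by
    intro t
    induction t with
    | zero => simp [T]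
    | add c d hc hd => simpa [T, mul_add] using congrArg₂ (· + ·) hc hd
    | tmul c d => simp [T]
  rw [← h2, h1, map_sliceRight]
  generalize comul (R := k) x = s
  induction s with
  | zero => simp
  | add a b ha hb => simp only [map_add, ha, hb]
  | tmul a b => simp

/-- The antipode is injective as soon as there is a non-zero right integral `χ`: the left kernel
of the pairing `(h, x) ↦ χ(S(h) x)` is a left ideal and a left coideal. -/
theorem IsRightIntegral.antipode_injective {χ : H →ₗ[k] k} (hχ : IsRightIntegral χ) (h0 : χ ≠ 0) :
    Function.Injective (antipode k (A := H)) := by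
  let N : Submodule k H := LinearMap.ker ((LinearMap.mul k H).compr₂ χ ∘ₗ antipode k)
  have hN : ∀ h, h ∈ N ↔ ∀ x, χ (antipode k h * x) = 0 := fun h => by
    simp [N, LinearMap.ext_iff]
  have hbot : N = ⊥ := by
    apply eq_bot_of_isLeftIdeal_of_isLeftCoideal
    · intro g n hn
      rw [hN] at hn ⊢
      intro x
      rw [antipode_mul_antidistrib, mul_assoc]
      exact hn _
    · intro n hn f
      rw [hN] at hn ⊢
      intro x
      have h1 : χ ∘ₗ mulLeft k (antipode k n) = 0 := by ext y; simpa using hn y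
      have h2 := hχ.sliceLeft_antipode_mul n x
      have h3 := apply_sliceLeft (χ ∘ₗ mulRight k x ∘ₗ antipode k) f (comul (R := k) n)
      rw [← h2, h1] at h3
      simpa [sliceLeft] using h3
    · rw [hN]
      intro h
      exact h0 (by ext x; simpa using h x)
  rw [← LinearMap.ker_eq_bot, eq_bot_iff]
  intro h hh
  rw [← hbot, hN]
  intro x
  rw [LinearMap.mem_ker.1 hh, zero_mul, map_zero]

/-- The pairing `(x, h) ↦ χ(x h)` given by a non-zero left integral has zero right kernel, which is
a left ideal and a left coideal. -/
theorem IsLeftIntegral.eq_zero_of_forall {χ : H →ₗ[k] k} (hχ : IsLeftIntegral χ) (h0 : χ ≠ 0)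
    (h : H) (hh : ∀ x, χ (x * h) = 0) : h = 0 := by
  let N : Submodule k H := LinearMap.ker ((LinearMap.mul k H).flip.compr₂ χ)
  have hN : ∀ h, h ∈ N ↔ ∀ x, χ (x * h) = 0 := fun h => by
    simp [N, LinearMap.ext_iff]
  have hbot : N = ⊥ := by
    apply eq_bot_of_isLeftIdeal_of_isLeftCoideal
    · intro g n hn
      rw [hN] at hn ⊢
      intro x
      rw [← mul_assoc]
      exact hn _
    · intro n hn f
      rw [hN] at hn ⊢
      intro x
      have h1 : χ ∘ₗ mulRight k n = 0 := by ext y; simpa using hn y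
      have h2 := hχ.sliceRight_mulLeft n x
      have h3 := apply_sliceLeft (χ ∘ₗ mulLeft k x) f (comul (R := k) n)
      rw [h2, h1] at h3
      simpa [sliceRight] using h3
    · rw [hN]
      intro h
      exact h0 (by ext x; simpa using h x)
  have : h ∈ N := (hN h).2 hh
  simpa [hbot] using this

/-- If `χ` is a left integral, then `χ ∘ S` is a right integral. With `F(a) = χ(S(a)) 1`, the
integral property of `χ` at `S(a)` says `F = F * S` in the convolution algebra, hence
`F * id = F`. -/
theorem IsLeftIntegral.isRightIntegral_comp_antipode {χ : H →ₗ[k] k} (hχ : IsLeftIntegral χ) :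
    IsRightIntegral (χ ∘ₗ antipode k) := by
  let F : H →ₗ[k] H := toSpanSingleton k H 1 ∘ₗ χ ∘ₗ antipode k
  have h1 : toConv F * toConv (antipode k) = toConv F := by
    ext a
    have h2 := hχ (antipode k a)
    have h3 := LinearMap.congr_fun (comul_comp_antipode (k := k) (H := H)) a
    simp only [LinearMap.comp_apply] at h3
    rw [h3] at h2
    refine Eq.trans ?_ h2
    simp only [convMul_apply, LinearEquiv.coe_coe]
    generalize comul (R := k) a = s
    induction s with
    | zero => simp
    | add a b ha hb => simp only [map_add, ha, hb]
    | tmul a b => simp [F]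
  have h4 : toConv F * toConv LinearMap.id = toConv F := by
    rw [← h1, mul_assoc, antipode_mul_id, mul_one, h1]
  intro a
  refine Eq.trans ?_ (LinearMap.congr_fun (congrArg WithConv.ofConv h4) a)
  change _ = mul' k H (map F LinearMap.id (comul (R := k) a))
  generalize comul (R := k) a = s
  induction s with
  | zero => simp
  | add a b ha hb => simp only [map_add, ha, hb]
  | tmul a b => simp [F]

/-- If `χ ∘ S = 0`, then the elements `∑ χ(h₁) h₂` are in the right kernel of `(x, h) ↦ χ(x h)`,
hence vanish, and applying `ε` gives `χ = 0`. -/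
theorem IsLeftIntegral.comp_antipode_ne_zero {χ : H →ₗ[k] k} (hχ : IsLeftIntegral χ)
    (h0 : χ ≠ 0) : χ ∘ₗ antipode k ≠ 0 := by
  intro hS
  apply h0
  ext h
  have h1 : sliceLeft χ (comul (R := k) h) = 0 := by
    refine hχ.eq_zero_of_forall h0 _ fun x => ?_
    have h2 := apply_sliceLeft (χ ∘ₗ mulLeft k x) χ (comul (R := k) h)
    rw [hχ.sliceRight_mulLeft] at h2
    exact h2.trans (LinearMap.congr_fun hS _)
  have h3 := apply_sliceLeft (counit (R := k)) χ (comul (R := k) h)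
  rw [h1] at h3
  simpa [sliceRight] using h3.symm

end Integral

/-! ### Comodules: subcomodules, matrix coefficients, duals -/

namespace RightComodule

variable {k : Type u} [Field k] {H : Type v} [Ring H] [HopfAlgebra k H]
variable {M : Type w} [AddCommGroup M] [Module k M]
variable {N : Type w'} [AddCommGroup N] [Module k N]
variable {P : Type w''} [AddCommGroup P] [Module k P]

open Coalgebra HopfAlgebra

/-- A subspace is a subcomodule exactly when it is stable under the action
`x ↦ ∑ x₀ f(x₁)` of the functionals `f` on `H`. -/
theorem isSubcomodule_iff (ρ : RightComodule k H M) (L : Submodule k M) :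
    ρ.IsSubcomodule L ↔ ∀ x ∈ L, ∀ f : H →ₗ[k] k, sliceRight f (ρ.coact x) ∈ L :=
  ⟨fun h x hx f => sliceRight_mem_of_mem_range L (h x hx) f,
    fun h x hx => mem_range_rTensor_subtype L _ (h x hx)⟩

theorem IsHom.apply {ρ : RightComodule k H M} {σ : RightComodule k H N} {f : M →ₗ[k] N}
    (hf : ρ.IsHom σ f) (x : M) : σ.coact (f x) = f.rTensor H (ρ.coact x) :=
  LinearMap.congr_fun hf x

theorem IsHom.comp {ρ : RightComodule k H M} {σ : RightComodule k H N} {τ : RightComodule k H P}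
    {g : N →ₗ[k] P} {f : M →ₗ[k] N} (hg : σ.IsHom τ g) (hf : ρ.IsHom σ f) :
    ρ.IsHom τ (g ∘ₗ f) := by
  ext x
  simp only [LinearMap.comp_apply, LinearMap.rTensor_comp, hg.apply, hf.apply]

theorem IsHom.symm {ρ : RightComodule k H M} {σ : RightComodule k H N} {e : M ≃ₗ[k] N}
    (he : ρ.IsHom σ e.toLinearMap) : σ.IsHom ρ e.symm.toLinearMap := by
  ext x
  obtain ⟨y, rfl⟩ := e.surjective x
  have h := he.apply y
  simp only [LinearEquiv.coe_coe] at h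
  simp only [LinearMap.comp_apply, LinearEquiv.coe_coe, LinearEquiv.symm_apply_apply]
  rw [h, ← LinearMap.comp_apply, ← LinearMap.rTensor_comp]
  simp

theorem IsHom.isSubcomodule_map {ρ : RightComodule k H M} {σ : RightComodule k H N}
    {f : M →ₗ[k] N} (hf : ρ.IsHom σ f) {L : Submodule k M} (hL : ρ.IsSubcomodule L) :
    σ.IsSubcomodule (L.map f) := by
  rw [isSubcomodule_iff] at hL ⊢
  rintro _ ⟨x, hx, rfl⟩ g
  rw [hf.apply, ← map_sliceRight]
  exact ⟨_, hL x hx g, rfl⟩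

theorem IsHom.isSubcomodule_ker {ρ : RightComodule k H M} {σ : RightComodule k H N}
    {f : M →ₗ[k] N} (hf : ρ.IsHom σ f) : ρ.IsSubcomodule (LinearMap.ker f) := by
  rw [isSubcomodule_iff]
  intro x hx g
  rw [LinearMap.mem_ker] at hx ⊢
  rw [map_sliceRight, ← hf.apply, hx, map_zero, map_zero]

/-- A morphism out of an essential extension of the trivial comodule is injective if it does not
kill the image of `1`. -/
theorem IsHom.injective_of_essential {σ : RightComodule k H M} {τ : RightComodule k H N}
    {i : k →ₗ[k] M}
    (hess : ∀ L : Submodule k M, σ.IsSubcomodule L → L ≠ ⊥ → L ⊓ LinearMap.range i ≠ ⊥)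
    {f : M →ₗ[k] N} (hf : σ.IsHom τ f) (h1 : f (i 1) ≠ 0) : Function.Injective f := by
  rw [← LinearMap.ker_eq_bot]
  by_contra hne
  apply hess _ hf.isSubcomodule_ker hne
  rw [eq_bot_iff]
  rintro _ ⟨hx, c, rfl⟩
  have hc : i c = c • i 1 := by rw [← map_smul, smul_eq_mul, mul_one]
  rw [SetLike.mem_coe, LinearMap.mem_ker, hc, map_smul, smul_eq_zero] at hx
  rw [Submodule.mem_bot, hc, hx.resolve_right h1, zero_smul]

theorem isHom_subtype_restrict (ρ : RightComodule k H M) (L : Submodule k M)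
    (hL : ρ.IsSubcomodule L) : (ρ.restrict L hL).IsHom ρ L.subtype :=
  (ρ.subtype_rTensor_comp_restrictCoact L hL).symm

/-- The map of matrix coefficients `M → H`, `x ↦ ∑ g(x₀) x₁`, of a functional `g` on `M`. -/
noncomputable def coeffMap (ρ : RightComodule k H M) (g : M →ₗ[k] k) : M →ₗ[k] H :=
  sliceLeft g ∘ₗ ρ.coact

theorem coeffMap_apply (ρ : RightComodule k H M) (g : M →ₗ[k] k) (x : M) :
    ρ.coeffMap g x = sliceLeft g (ρ.coact x) := rfl

theorem isHom_coeffMap (ρ : RightComodule k H M) (g : M →ₗ[k] k) :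
    ρ.IsHom (regular k H) (ρ.coeffMap g) := by
  have h1 : ∀ s : M ⊗[k] H, sliceLeft g (TensorProduct.assoc k M H H (ρ.coact.rTensor H s)) =
      (ρ.coeffMap g).rTensor H s := by
    intro s
    induction s with
    | zero => simp
    | add a b ha hb => simp only [map_add, ha, hb]
    | tmul m h =>
      simp only [LinearMap.rTensor_tmul, coeffMap_apply]
      generalize ρ.coact m = t
      induction t with
      | zero => simp
      | add a b ha hb => simp only [TensorProduct.add_tmul, map_add, ha, hb]
      | tmul a b => simp [TensorProduct.smul_tmul']
  ext x
  have h2 := LinearMap.congr_fun ρ.coassoc x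
  simp only [LinearMap.comp_apply, LinearEquiv.coe_coe] at h2
  change comul (R := k) (sliceLeft g (ρ.coact x)) = _
  rw [map_sliceLeft, ← h2, h1]
  rfl

/-- A morphism `f` to the regular comodule is the map of matrix coefficients of `ε ∘ f`. -/
theorem IsHom.eq_coeffMap {ρ : RightComodule k H M} {f : M →ₗ[k] H}
    (hf : ρ.IsHom (regular k H) f) : f = ρ.coeffMap (counit (R := k) ∘ₗ f) := by
  ext x
  have h1 : ∀ s : M ⊗[k] H, sliceLeft (counit (R := k) ∘ₗ f) s =
      sliceLeft (counit (R := k)) (f.rTensor H s) := by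
    intro s
    induction s with
    | zero => simp
    | add a b ha hb => simp only [map_add, ha, hb]
    | tmul m h => simp
  rw [coeffMap_apply, h1, ← hf.apply]
  change _ = sliceLeft _ (comul (R := k) (f x))
  simp [sliceLeft]

theorem IsHom.coeffMap_comp {ρ : RightComodule k H M} {σ : RightComodule k H N} {f : M →ₗ[k] N}
    (hf : ρ.IsHom σ f) (g : N →ₗ[k] k) : σ.coeffMap g ∘ₗ f = ρ.coeffMap (g ∘ₗ f) := by
  ext x
  simp only [LinearMap.comp_apply, coeffMap_apply, hf.apply]
  generalize ρ.coact x = s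
  induction s with
  | zero => simp
  | add a b ha hb => simp only [map_add, ha, hb]
  | tmul m h => simp

/-- The regular comodule is injective, because morphisms into it amount to linear functionals. -/
theorem isInjective_regular : IsInjective.{u, v, v, w} (regular k H) := by
  intro X Y _ _ _ _ ρX ρY f g hf hfi hg
  obtain ⟨r, hr⟩ := f.exists_leftInverse_of_injective (LinearMap.ker_eq_bot.2 hfi)
  refine ⟨ρY.coeffMap (counit (R := k) ∘ₗ g ∘ₗ r), ρY.isHom_coeffMap _, ?_⟩
  rw [hf.coeffMap_comp, LinearMap.comp_assoc, LinearMap.comp_assoc, hr, LinearMap.comp_id]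
  exact hg.eq_coeffMap.symm

/-- A retract of an injective comodule is injective. -/
theorem IsInjective.of_retract {σ : RightComodule k H N} {τ : RightComodule k H P}
    (hτ : IsInjective.{u, v, w'', w} τ) {j : N →ₗ[k] P} {q : P →ₗ[k] N} (hj : σ.IsHom τ j)
    (hq : τ.IsHom σ q) (hqj : q ∘ₗ j = LinearMap.id) : IsInjective.{u, v, w', w} σ := by
  intro X Y _ _ _ _ ρX ρY f g hf hfi hg
  obtain ⟨h, hh, hhf⟩ := hτ X Y ρX ρY f (j ∘ₗ g) hf hfi (hj.comp hg)
  exact ⟨q ∘ₗ h, hq.comp hh, by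
    rw [LinearMap.comp_assoc, hhf, ← LinearMap.comp_assoc, hqj, LinearMap.id_comp]⟩

/-- If the antipode is injective, then the annihilator in `M` of a subcomodule of `M^*` is a
subcomodule. -/
theorem isSubcomodule_dualCoannihilator (hS : Function.Injective (antipode k (A := H)))
    (ρ : RightComodule k H M) [FiniteDimensional k M] {L : Submodule k (Module.Dual k M)}
    (hL : ρ.dual.IsSubcomodule L) : ρ.IsSubcomodule L.dualCoannihilator := by
  rw [isSubcomodule_iff]
  intro x hx f
  rw [Submodule.mem_dualCoannihilator] at hx ⊢
  intro φ hφ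
  have h1 : dualTensorHom k M H (ρ.dualCoact φ) x = 0 := by
    obtain ⟨s, hs⟩ := hL φ hφ
    change _ = ρ.dualCoact φ at hs
    rw [← hs]
    clear hs
    induction s with
    | zero => simp
    | add a b ha hb => simp only [map_add, LinearMap.add_apply, ha, hb, add_zero]
    | tmul a b => simp [hx a a.2]
  rw [dualTensorHom_dualCoact] at h1
  have h2 : sliceLeft φ (ρ.coact x) = 0 := hS (h1.trans (map_zero _).symm)
  rw [← apply_sliceLeft f φ, h2, map_zero]

/-- Every element `x` of a comodule is contained in a finite-dimensional subcomodule, namely the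
space of all `∑ x₀ f(x₁)`, where `f` is a functional on `H`. -/
theorem exists_finiteDimensional_isSubcomodule (ρ : RightComodule k H M) (x : M) :
    ∃ L : Submodule k M, ρ.IsSubcomodule L ∧ FiniteDimensional k L ∧ x ∈ L := by
  let Φ : (H →ₗ[k] k) →ₗ[k] M :=
    { toFun := fun f => sliceRight f (ρ.coact x)
      map_add' := fun f g => by simp [sliceRight, LinearMap.lTensor_add]
      map_smul' := fun c f => by simp [sliceRight, LinearMap.lTensor_smul] }
  have hΦ : ∀ f, Φ f = sliceRight f (ρ.coact x) := fun _ => rfl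
  refine ⟨LinearMap.range Φ, ?_, ?_, ?_⟩
  · rw [isSubcomodule_iff]
    rintro _ ⟨f, rfl⟩ g
    -- `id ⊗ g` after `id ⊗ f` is the slice by the convolution product `g * f`.
    let gf : H →ₗ[k] k := g ∘ₗ sliceRight f ∘ₗ comul
    refine ⟨gf, ?_⟩
    have h1 : ∀ s : M ⊗[k] H, sliceRight gf s =
        sliceRight g ((sliceRight f).lTensor M (comul.lTensor M s)) := by
      intro s
      induction s with
      | zero => simp
      | add a b ha hb => simp only [map_add, ha, hb]
      | tmul a b => simp [gf]
    have h2 : ∀ s : M ⊗[k] H, (sliceRight f).lTensor M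
        (TensorProduct.assoc k M H H (ρ.coact.rTensor H s)) = ρ.coact (sliceRight f s) := by
      intro s
      induction s with
      | zero => simp
      | add a b ha hb => simp only [map_add, ha, hb]
      | tmul m h =>
        simp only [LinearMap.rTensor_tmul, sliceRight_tmul, map_smul]
        generalize ρ.coact m = t
        induction t with
        | zero => simp
        | add a b ha hb => simp only [TensorProduct.add_tmul, map_add, ha, hb, smul_add]
        | tmul a b => simp
    have h3 := LinearMap.congr_fun ρ.coassoc x
    simp only [LinearMap.comp_apply, LinearEquiv.coe_coe] at h3
    rw [hΦ, hΦ, h1, ← h3, h2]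
  · -- The slices of a tensor lie in the span of its finitely many left factors.
    have h4 : ∀ s : M ⊗[k] H, ∃ W : Submodule k M, FiniteDimensional k W ∧
        ∀ f : H →ₗ[k] k, sliceRight f s ∈ W := by
      intro s
      induction s with
      | zero => exact ⟨⊥, inferInstance, fun f => by simp⟩
      | add a b ha hb =>
        obtain ⟨W, hW, ha⟩ := ha
        obtain ⟨W', hW', hb⟩ := hb
        exact ⟨W ⊔ W', inferInstance, fun f => by
          rw [map_add]
          exact Submodule.add_mem_sup (ha f) (hb f)⟩
      | tmul a b =>
        exact ⟨k ∙ a, inferInstance, fun f => by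
          rw [sliceRight_tmul]
          exact Submodule.smul_mem _ _ (Submodule.mem_span_singleton_self a)⟩
    obtain ⟨W, hW, h⟩ := h4 (ρ.coact x)
    refine Submodule.finiteDimensional_of_le (S₂ := W) ?_
    rintro _ ⟨f, rfl⟩
    exact h f
  · exact ⟨counit (R := k), LinearMap.congr_fun ρ.counit_coact x⟩

end RightComodule

/-! ### Coideals on which a right integral does not vanish -/

section Coideal

open Coalgebra HopfAlgebra RightComodule

variable {k : Type u} [Field k] {H : Type v} [Ring H] [HopfAlgebra k H]

/-- The map `H → J^*` sending `h` to the functional `x ↦ χ(h x)`. -/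
noncomputable def translateRestrict (χ : H →ₗ[k] k) (J : Submodule k H) :
    H →ₗ[k] Module.Dual k J :=
  ((LinearMap.mul k H).compr₂ χ).compl₂ J.subtype

theorem translateRestrict_apply (χ : H →ₗ[k] k) (J : Submodule k H) (h : H) (x : J) :
    translateRestrict χ J h x = χ (h * x) := rfl

theorem isHom_translateRestrict {χ : H →ₗ[k] k} (hχ : IsRightIntegral χ) (J : Submodule k H)
    (hJ : (regular k H).IsSubcomodule J) [FiniteDimensional k J] :
    (regular k H).IsHom ((regular k H).restrict J hJ).dual (translateRestrict χ J) := by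
  ext1 h
  apply (dualTensorHom_bijective (R := k) (M := J) (N := H)).1
  ext1 x
  change dualTensorHom k J H (((regular k H).restrict J hJ).dualCoact _) x =
    dualTensorHom k J H ((translateRestrict χ J).rTensor H (comul (R := k) h)) x
  have h1 : ∀ s : J ⊗[k] H, sliceLeft (translateRestrict χ J h) s =
      sliceLeft (χ ∘ₗ LinearMap.mulLeft k h) (J.subtype.rTensor H s) := by
    intro s
    induction s with
    | zero => simp
    | add a b ha hb => simp only [map_add, ha, hb]
    | tmul a b => simp [translateRestrict_apply]
  have h2 : ∀ s : H ⊗[k] H, dualTensorHom k J H ((translateRestrict χ J).rTensor H s) x =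
      sliceLeft (χ ∘ₗ LinearMap.mulRight k (x : H)) s := by
    intro s
    induction s with
    | zero => simp
    | add a b ha hb => simp only [map_add, LinearMap.add_apply, ha, hb]
    | tmul a b => simp [translateRestrict_apply]
  rw [dualTensorHom_dualCoact, h2, hχ.sliceLeft_mulRight]
  change antipode k (sliceLeft _ _) = _
  rw [h1, ← (isHom_subtype_restrict (regular k H) J hJ).apply]
  rfl

theorem restrictionMap_one (χ : H →ₗ[k] k) (J : Submodule k H) :
    restrictionMap χ J 1 = translateRestrict χ J 1 := by
  ext x
  simp [restrictionMap, translateRestrict_apply]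

theorem isHom_restrictionMap {χ : H →ₗ[k] k} (hχ : IsRightIntegral χ) (J : Submodule k H)
    (hJ : (regular k H).IsSubcomodule J) [FiniteDimensional k J] :
    (RightComodule.trivial k H).IsHom ((regular k H).restrict J hJ).dual (restrictionMap χ J) := by
  have h1 : restrictionMap χ J = translateRestrict χ J ∘ₗ LinearMap.toSpanSingleton k H 1 := by
    ext1
    simpa using restrictionMap_one χ J
  rw [h1]
  refine (isHom_translateRestrict hχ J hJ).comp ?_
  ext
  simp [RightComodule.trivial, regular, Algebra.TensorProduct.one_def]

theorem translateRestrict_one_ne_zero {χ : H →ₗ[k] k} {J : Submodule k H}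
    (hJ : ∃ x ∈ J, χ x ≠ 0) : translateRestrict χ J 1 ≠ 0 := by
  obtain ⟨x, hx, h⟩ := hJ
  intro h0
  have := LinearMap.congr_fun h0 ⟨x, hx⟩
  rw [translateRestrict_apply, one_mul] at this
  exact h this

/-- There is a finite-dimensional coideal of least dimension on which `χ ≠ 0` does not vanish. -/
theorem exists_isNonvanishingCoideal {χ : H →ₗ[k] k} (h0 : χ ≠ 0) :
    ∃ J : Submodule k H, IsNonvanishingCoideal χ J ∧
      ∀ J' : Submodule k H, IsNonvanishingCoideal χ J' →
        Module.finrank k J ≤ Module.finrank k J' := by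
  obtain ⟨x, hx⟩ : ∃ x, χ x ≠ 0 := by
    by_contra! h
    exact h0 (LinearMap.ext h)
  obtain ⟨J₀, h1, h2, h3⟩ := (regular k H).exists_finiteDimensional_isSubcomodule x
  obtain ⟨J, hJ, hmin⟩ := (InvImage.wf (fun J : Submodule k H => Module.finrank k J)
    wellFounded_lt).has_min {J | IsNonvanishingCoideal χ J} ⟨J₀, h1, h2, x, h3, hx⟩
  exact ⟨J, hJ, fun J' hJ' => not_lt.1 (hmin J' hJ')⟩

/-- If `J` is minimal, then `J^*` is an essential extension of `k χ|_J`: the annihilator in `J` of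
a subcomodule `L` of `J^*` is a coideal, so that it is all of `J` (and `L = 0`) or is killed by
`χ` (and `χ|_J ∈ L`). -/
theorem essential_restrictionMap {χ : H →ₗ[k] k} (hχ : IsRightIntegral χ) (J : Submodule k H)
    (hJ : (regular k H).IsSubcomodule J) [FiniteDimensional k J]
    (hmin : Minimal (IsNonvanishingCoideal χ) J) (L : Submodule k (Module.Dual k J))
    (hL : ((regular k H).restrict J hJ).dual.IsSubcomodule L) (hne : L ≠ ⊥) :
    L ⊓ LinearMap.range (restrictionMap χ J) ≠ ⊥ := by
  have hnv := hmin.prop.nonvanishing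
  have h0 : χ ≠ 0 := by
    rintro rfl
    simp at hnv
  have hsub := isSubcomodule_dualCoannihilator (hχ.antipode_injective h0) _ hL
  by_cases hv : ∃ x ∈ L.dualCoannihilator, χ (x : H) ≠ 0
  · exfalso
    apply hne
    obtain ⟨x, hx, hχx⟩ := hv
    have h1 : IsNonvanishingCoideal χ (L.dualCoannihilator.map J.subtype) :=
      ⟨(isHom_subtype_restrict _ J hJ).isSubcomodule_map hsub, inferInstance,
        x, ⟨x, hx, rfl⟩, hχx⟩
    have h2 : J ≤ L.dualCoannihilator.map J.subtype :=
      hmin.le_of_le h1 (Submodule.map_subtype_le J _)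
    rw [eq_bot_iff]
    intro φ hφ
    rw [Submodule.mem_bot]
    ext y
    obtain ⟨z, hz, hzy⟩ := h2 y.2
    obtain rfl : z = y := Subtype.ext hzy
    exact (Submodule.mem_dualCoannihilator _).1 hz φ hφ
  · push Not at hv
    have h1 : restrictionMap χ J 1 ∈ L := by
      rw [← Subspace.dualCoannihilator_dualAnnihilator_eq (W := L),
        Submodule.mem_dualAnnihilator, restrictionMap_one]
      intro x hx
      rw [translateRestrict_apply, one_mul]
      exact hv x hx
    intro hbot
    have h2 : restrictionMap χ J 1 ∈ L ⊓ LinearMap.range (restrictionMap χ J) := ⟨h1, 1, rfl⟩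
    rw [hbot, Submodule.mem_bot, restrictionMap_one] at h2
    exact translateRestrict_one_ne_zero hnv h2

/-- An essential extension of the trivial comodule embeds in `J^*`, through a map of matrix
coefficients to `H` which sends the image of `1` to `1`, followed by `h ↦ χ(h ·)`. -/
theorem exists_injective_translateRestrict_comp_coeffMap {χ : H →ₗ[k] k}
    (hχ : IsRightIntegral χ) {J : Submodule k H} (hJ : IsNonvanishingCoideal χ J) {E : Type w}
    [AddCommGroup E] [Module k E] {σ : RightComodule k H E} {i : k →ₗ[k] E}
    (hi : (RightComodule.trivial k H).IsHom σ i) (hinj : Function.Injective i)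
    (hess : ∀ L : Submodule k E, σ.IsSubcomodule L → L ≠ ⊥ → L ⊓ LinearMap.range i ≠ ⊥) :
    ∃ g : E →ₗ[k] k, Function.Injective (translateRestrict χ J ∘ₗ σ.coeffMap g) := by
  have := hJ.finiteDimensional
  obtain ⟨g, hg⟩ := i.exists_leftInverse_of_injective (LinearMap.ker_eq_bot.2 hinj)
  refine ⟨g, ((isHom_translateRestrict hχ J hJ.isSubcomodule).comp
    (σ.isHom_coeffMap g)).injective_of_essential hess ?_⟩
  have h1 : σ.coeffMap g (i 1) = 1 := by
    have h2 : g (i 1) = 1 := LinearMap.congr_fun hg 1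
    rw [coeffMap_apply, hi.apply]
    simp [RightComodule.trivial, h2]
  rw [LinearMap.comp_apply, h1]
  exact translateRestrict_one_ne_zero hJ.nonvanishing

theorem restrictionMap_injective {χ : H →ₗ[k] k} {J : Submodule k H}
    (hJ : ∃ x ∈ J, χ x ≠ 0) : Function.Injective (restrictionMap χ J) := by
  refine LinearMap.ker_eq_bot.1 (LinearMap.ker_toSpanSingleton k (x := χ.domRestrict J) ?_)
  obtain ⟨x, hx, h⟩ := hJ
  exact fun h0 => h (LinearMap.congr_fun h0 ⟨x, hx⟩)

/-- If `J` is minimal, then the composite of a suitable map of matrix coefficients `J^* → H` with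
`H → J^*`, `h ↦ χ(h ·)`, is injective by essentiality and bijective by finite dimension, so that
`J^*` is a retract of the injective comodule `H`. -/
theorem isInjective_dual_restrict {χ : H →ₗ[k] k} (hχ : IsRightIntegral χ) (J : Submodule k H)
    (hJ : (regular k H).IsSubcomodule J) [FiniteDimensional k J]
    (hmin : Minimal (IsNonvanishingCoideal χ) J) :
    IsInjective.{u, v, max u v, w} ((regular k H).restrict J hJ).dual := by
  obtain ⟨g, hg⟩ := exists_injective_translateRestrict_comp_coeffMap hχ hmin.prop
    (isHom_restrictionMap hχ J hJ) (restrictionMap_injective hmin.prop.nonvanishing)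
    (essential_restrictionMap hχ J hJ hmin)
  have hj := ((regular k H).restrict J hJ).dual.isHom_coeffMap g
  have hΘ := isHom_translateRestrict hχ J hJ
  let e := LinearEquiv.ofInjectiveEndo _ hg
  have he : ((regular k H).restrict J hJ).dual.IsHom _ e.toLinearMap := hΘ.comp hj
  refine isInjective_regular.of_retract hj (he.symm.comp hΘ) ?_
  ext1 φ
  exact e.symm_apply_apply φ

theorem isInjectiveEnvelope_restrictionMap {χ : H →ₗ[k] k} (hχ : IsRightIntegral χ)
    (J : Submodule k H) (hJ : (regular k H).IsSubcomodule J) [FiniteDimensional k J]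
    (hmin : Minimal (IsNonvanishingCoideal χ) J) :
    IsInjectiveEnvelope.{u, v, u, max u v, w} (RightComodule.trivial k H)
      ((regular k H).restrict J hJ).dual (restrictionMap χ J) where
  isHom := isHom_restrictionMap hχ J hJ
  injective := restrictionMap_injective hmin.prop.nonvanishing
  isInjective := isInjective_dual_restrict hχ J hJ hmin
  essential := essential_restrictionMap hχ J hJ hmin

end Coideal

end HopfComodule

theorem mainTheorem3 {k : Type u} [Field k] {H : Type v} [Ring H] [HopfAlgebra k H]
    (hint : (∃ χ : H →ₗ[k] k, χ ≠ 0 ∧ HopfComodule.IsRightIntegral χ) ∨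
      (∃ χ : H →ₗ[k] k, χ ≠ 0 ∧ HopfComodule.IsLeftIntegral χ)) :
    -- every injective envelope of the trivial comodule is finite-dimensional
    (∀ (E : Type w) [AddCommGroup E] [Module k E] (σ : HopfComodule.RightComodule k H E)
      (i : k →ₗ[k] E),
      HopfComodule.RightComodule.IsInjectiveEnvelope.{u, v, u, w, w}
        (HopfComodule.RightComodule.trivial k H) σ i → FiniteDimensional k E) ∧
    -- there is a non-zero right integral
    (∃ χ : H →ₗ[k] k, χ ≠ 0 ∧ HopfComodule.IsRightIntegral χ) ∧
    ∀ χ : H →ₗ[k] k, χ ≠ 0 → HopfComodule.IsRightIntegral χ →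
      -- there is a finite-dimensional right coideal of least dimension on which it is non-zero
      (∃ J : Submodule k H, HopfComodule.IsNonvanishingCoideal χ J ∧
        (∀ J' : Submodule k H, HopfComodule.IsNonvanishingCoideal χ J' →
          Module.finrank k J ≤ Module.finrank k J') ∧
        Minimal (HopfComodule.IsNonvanishingCoideal χ) J) ∧
      -- the dual of any minimal one is an injective envelope of the trivial comodule
      ∀ (J : Submodule k H) (hJ : (HopfComodule.RightComodule.regular k H).IsSubcomodule J)
        [FiniteDimensional k J], Minimal (HopfComodule.IsNonvanishingCoideal χ) J →
        HopfComodule.RightComodule.IsInjectiveEnvelope.{u, v, u, max u v, w}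
          (HopfComodule.RightComodule.trivial k H)
          ((HopfComodule.RightComodule.regular k H).restrict J hJ).dual
          (HopfComodule.restrictionMap χ J) := by
  have hright : ∃ χ : H →ₗ[k] k, χ ≠ 0 ∧ HopfComodule.IsRightIntegral χ :=
    hint.elim id fun ⟨χ, h0, hχ⟩ =>
      ⟨χ ∘ₗ HopfAlgebra.antipode k, hχ.comp_antipode_ne_zero h0, hχ.isRightIntegral_comp_antipode⟩
  refine ⟨?_, hright, ?_⟩
  · intro E _ _ σ i hE
    obtain ⟨χ, h0, hχ⟩ := hright
    obtain ⟨J, hJ, -⟩ := HopfComodule.exists_isNonvanishingCoideal h0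
    have := hJ.finiteDimensional
    obtain ⟨g, hg⟩ := HopfComodule.exists_injective_translateRestrict_comp_coeffMap hχ hJ
      hE.isHom hE.injective hE.essential
    exact FiniteDimensional.of_injective _ hg
  · intro χ h0 hχ
    refine ⟨?_, fun J hJ _ hmin => HopfComodule.isInjectiveEnvelope_restrictionMap hχ J hJ hmin⟩
    obtain ⟨J, hJ, hleast⟩ := HopfComodule.exists_isNonvanishingCoideal h0
    refine ⟨J, hJ, hleast, hJ, fun J' hJ' hle => ?_⟩
    have := hJ.finiteDimensional
    exact (Submodule.eq_of_le_of_finrank_le hle (hleast J' hJ')).ge
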